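/- Let $\mathcal{M}_n$ be the algebra of complex $n\times n$ matrices, and identify $\mathcal{M}_k\otimes\mathcal{M}_m$ with $\mathcal{M}_{km}$ via the Kronecker product. For $\gamma=\sum_{i=1}^n A_i\otimes B_i\in\mathcal{M}_k\otimes\mathcal{M}_m$ define the linear maps $G_\gamma:\mathcal{M}_k\to\mathcal{M}_m$, $G_\gamma(X)=\sum_i \operatorname{tr}(A_iX)B_i$, and $F_\gamma:\mathcal{M}_m\to\mathcal{M}_k$, $F_\gamma(X)=\sum_i\operatorname{tr}(B_iX)A_i$. A state is a positive semidefinite Hermitian $\gamma$ (not necessarily normalized). An orthogonal projection is a matrix $W$ with $W=W^2=W^*$, and $W^\perp=Id-W$. Let $T:\mathcal{M}_k\to\mathcal{M}_k$ be linear, positive (it maps positive semidefinite Hermitian matrices to such matrices) and self-adjoint with respect to the trace inner product $\langle X,Y\rangle=\operatorname{tr}(XY^*)$. For an orthogonal projection $V$ with $T(V\mathcal{M}_kV)\subset V\mathcal{M}_kV$, the restriction $T|_{V\mathcal{M}_kV}$ is irreducible if the only orthogonal projections $W$ with $W\mathcal{M}_kW\subset V\mathcal{M}_kV$ and $T(W\mathcal{M}_kW)\subset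 W\mathcal{M}_kW$ are $W=0$ and $W=V$. The map $T$ is completely reducible if there are orthogonal projections $W_1,\dots,W_l\in\mathcal{M}_k$ ($l\ge 0$) with $W_iW_j=0$ for $i\ne j$ and $\mathcal{M}_k=\bigoplus_{i=1}^l W_i\mathcal{M}_kW_i\oplus R$, where $R$ is the orthogonal complement of $\bigoplus_i W_i\mathcal{M}_kW_i$ with respect to the trace inner product, such that $T(W_i\mathcal{M}_kW_i)\subset W_i\mathcal{M}_kW_i$ and $T|_{W_i\mathcal{M}_kW_i}$ is irreducible for every $i$, and $T|_R\equiv 0$. Let $CR_{k,m}$ be the set of states $\gamma\in\mathcal{M}_k\otimes\mathcal{M}_m$ such that $F_\gamma\circ G_\gamma:\mathcal{M}_k\to\mathcal{M}_k$ is completely reducible. Corollary. Let $\gamma\in\mathcal{M}_k\otimes\mathcal{M}_m$ be a state. Then $\gamma\in CR_{k,m}$ if and only if for every pair of orthogonal projections $W\in\mathcal{M}_k$ and $V\in\mathcal{M}_m$ the following two conditions are equivalent: a) $\operatorname{tr}(\gamma(W\otimes V^\perp))=\operatorname{tr}(\gamma(W^\perp\otimes V))=0$; b) $\gamma=(W\otimes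 V)\gamma(W\otimes V)+(W^\perp\otimes V^\perp)\gamma(W^\perp\otimes V^\perp)$. -/

import Mathlib

open scoped Kronecker ComplexOrder Matrix

/-- The sub-algebra `V M_n V = {V X V : X ∈ M_n}` of `M_n`. -/
def corner {n : ℕ} (V : Matrix (Fin n) (Fin n) ℂ) :
    Submodule ℂ (Matrix (Fin n) (Fin n) ℂ) where
  carrier := {Y | ∃ X : Matrix (Fin n) (Fin n) ℂ, Y = V * X * V}
  add_mem' := by
    rintro _ _ ⟨X, rfl⟩ ⟨Y, rfl⟩
    exact ⟨X + Y, by rw [mul_add, add_mul]⟩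
  zero_mem' := ⟨0, by simp⟩
  smul_mem' := by
    rintro c _ ⟨X, rfl⟩
    exact ⟨c • X, by simp⟩

/-- The orthogonal complement of a subspace of `M_n` with respect to the trace inner product
`⟨X, Y⟩ = tr (X Y*)`. -/
def traceOrthogonal {n : ℕ} (S : Submodule ℂ (Matrix (Fin n) (Fin n) ℂ)) :
    Submodule ℂ (Matrix (Fin n) (Fin n) ℂ) where
  carrier := {Y | ∀ Z ∈ S, (Y * Zᴴ).trace = 0}
  add_mem' := by
    intro X Y hX hY Z hZ
    rw [add_mul, Matrix.trace_add, hX Z hZ, hY Z hZ, add_zero]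
  zero_mem' := by
    intro Z _
    simp
  smul_mem' := by
    intro c X hX Z hZ
    rw [Matrix.smul_mul, Matrix.trace_smul, hX Z hZ, smul_zero]

/-- The linear map `T` sends the sub-algebra `V M_n V` into itself. -/
def LeavesInvariant {n : ℕ} (T : Matrix (Fin n) (Fin n) ℂ →ₗ[ℂ] Matrix (Fin n) (Fin n) ℂ)
    (V : Matrix (Fin n) (Fin n) ℂ) : Prop :=
  ∀ X ∈ corner V, T X ∈ corner V

/-- Positive maps: positive semidefinite Hermitian matrices are sent to such matrices. -/
def IsPositiveMap {n : ℕ}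
    (T : Matrix (Fin n) (Fin n) ℂ →ₗ[ℂ] Matrix (Fin n) (Fin n) ℂ) : Prop :=
  ∀ X : Matrix (Fin n) (Fin n) ℂ, X.PosSemidef → (T X).PosSemidef

/-- Self-adjointness with respect to the trace inner product. -/
def IsTraceSelfAdjoint {n : ℕ}
    (T : Matrix (Fin n) (Fin n) ℂ →ₗ[ℂ] Matrix (Fin n) (Fin n) ℂ) : Prop :=
  ∀ X Y : Matrix (Fin n) (Fin n) ℂ, (T X * Yᴴ).trace = (X * (T Y)ᴴ).trace

/-- Irreducibility of the restriction to `V M_n V` of a positive map `T` that leaves `V M_n V`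
invariant: the only sub-algebras `W M_n W ⊆ V M_n V`, with `W` an orthogonal projection, that
are left invariant by `T` are those with `W = 0` or `W = V`. -/
def IsIrreducibleOn {n : ℕ} (T : Matrix (Fin n) (Fin n) ℂ →ₗ[ℂ] Matrix (Fin n) (Fin n) ℂ)
    (V : Matrix (Fin n) (Fin n) ℂ) : Prop :=
  ∀ W : Matrix (Fin n) (Fin n) ℂ, IsStarProjection W → corner W ≤ corner V →
    LeavesInvariant T W → W = 0 ∨ W = V

/-- Completely reducible self-adjoint positive maps `T : M_n → M_n`: there are pairwise orthogonal
projections `W_1, …, W_l` such that `M_n` is the direct sum of the `W_i M_n W_i` and of the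
orthogonal complement `R` of their sum, `T` leaves every `W_i M_n W_i` invariant and is irreducible
on it, and `T` vanishes on `R`. -/
def IsCompletelyReducible {n : ℕ}
    (T : Matrix (Fin n) (Fin n) ℂ →ₗ[ℂ] Matrix (Fin n) (Fin n) ℂ) : Prop :=
  IsPositiveMap T ∧ IsTraceSelfAdjoint T ∧
  ∃ (l : ℕ) (W : Fin l → Matrix (Fin n) (Fin n) ℂ),
    (∀ i, IsStarProjection (W i)) ∧
    (∀ i j, i ≠ j → W i * W j = 0) ∧
    iSupIndep (fun i => corner (W i)) ∧
    IsCompl (⨆ i, corner (W i)) (traceOrthogonal (⨆ i, corner (W i))) ∧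
    (∀ i, LeavesInvariant T (W i)) ∧
    (∀ i, IsIrreducibleOn T (W i)) ∧
    (∀ X ∈ traceOrthogonal (⨆ i, corner (W i)), T X = 0)

/-- The map `G_γ : M_k → M_m` of `γ ∈ M_k ⊗ M_m`, where `M_k ⊗ M_m` is identified with the
matrices indexed by `Fin k × Fin m` through the Kronecker product. For `γ = ∑ A_i ⊗ B_i` it is
`X ↦ ∑ tr (A_i X) B_i`, see `mapG_sum_kronecker`. -/
def mapG {k m : ℕ} (γ : Matrix (Fin k × Fin m) (Fin k × Fin m) ℂ) :
    Matrix (Fin k) (Fin k) ℂ →ₗ[ℂ] Matrix (Fin m) (Fin m) ℂ where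
  toFun X := Matrix.of fun i j => ∑ a, ∑ b, γ (a, i) (b, j) * X b a
  map_add' X Y := by
    ext i j
    simp [mul_add, Finset.sum_add_distrib]
  map_smul' c X := by
    ext i j
    simp [Finset.mul_sum, mul_left_comm]

/-- The map `F_γ : M_m → M_k` of `γ ∈ M_k ⊗ M_m`. For `γ = ∑ A_i ⊗ B_i` it is
`X ↦ ∑ tr (B_i X) A_i`, see `mapF_sum_kronecker`. -/
def mapF {k m : ℕ} (γ : Matrix (Fin k × Fin m) (Fin k × Fin m) ℂ) :
    Matrix (Fin m) (Fin m) ℂ →ₗ[ℂ] Matrix (Fin k) (Fin k) ℂ where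
  toFun X := Matrix.of fun a b => ∑ i, ∑ j, γ (a, i) (b, j) * X j i
  map_add' X Y := by
    ext a b
    simp [mul_add, Finset.sum_add_distrib]
  map_smul' c X := by
    ext a b
    simp [Finset.mul_sum, mul_left_comm]

theorem mapG_sum_kronecker {k m n : ℕ} (A : Fin n → Matrix (Fin k) (Fin k) ℂ)
    (B : Fin n → Matrix (Fin m) (Fin m) ℂ) (X : Matrix (Fin k) (Fin k) ℂ) :
    mapG (∑ s, A s ⊗ₖ B s) X = ∑ s, (A s * X).trace • B s := by
  ext i j
  simp only [mapG, LinearMap.coe_mk, AddHom.coe_mk, Matrix.of_apply, Matrix.sum_apply,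
    Matrix.kroneckerMap_apply, Matrix.smul_apply, smul_eq_mul, Matrix.trace, Matrix.diag_apply,
    Matrix.mul_apply, Finset.sum_mul]
  conv_rhs => rw [Finset.sum_comm]
  refine Finset.sum_congr rfl fun a _ => ?_
  rw [Finset.sum_comm]
  exact Finset.sum_congr rfl fun s _ => Finset.sum_congr rfl fun b _ => by ring

theorem mapF_sum_kronecker {k m n : ℕ} (A : Fin n → Matrix (Fin k) (Fin k) ℂ)
    (B : Fin n → Matrix (Fin m) (Fin m) ℂ) (X : Matrix (Fin m) (Fin m) ℂ) :
    mapF (∑ s, A s ⊗ₖ B s) X = ∑ s, (B s * X).trace • A s := by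
  ext i j
  simp only [mapF, LinearMap.coe_mk, AddHom.coe_mk, Matrix.of_apply, Matrix.sum_apply,
    Matrix.kroneckerMap_apply, Matrix.smul_apply, smul_eq_mul, Matrix.trace, Matrix.diag_apply,
    Matrix.mul_apply, Finset.sum_mul]
  conv_rhs => rw [Finset.sum_comm]
  refine Finset.sum_congr rfl fun a _ => ?_
  rw [Finset.sum_comm]
  exact Finset.sum_congr rfl fun s _ => Finset.sum_congr rfl fun b _ => by ring

/-- The set `CR_{k,m}` of completely reducible states of `M_k ⊗ M_m`. -/
def CR (k m : ℕ) : Set (Matrix (Fin k × Fin m) (Fin k × Fin m) ℂ) :=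
  {γ | γ.PosSemidef ∧ IsCompletelyReducible (mapF γ ∘ₗ mapG γ)}

/-!
Let `T = F_γ ∘ G_γ`. The maps `F_γ` and `G_γ` are positive, adjoint to each other, and
`tr (γ (X ⊗ Y)) = tr (G_γ(X) Y) = tr (F_γ(Y) X)`. For projections `W`, `V`, the vanishing of the two
traces therefore says that `G_γ(W)` is supported in `V` and `F_γ(V)` in `W`. This makes `W`, and by
symmetry `1 - W`, invariant under `T`; conversely every `T`-invariant projection `W` has such a
partner `V`, the range projection of `G_γ(W)`. Given the two traces, block diagonality of `γ` amounts
to `G_γ` killing the off-diagonal blocks `(1 - W) X W`, and `T X = 0` forces `G_γ(X) = 0`. The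
theorem thus reduces to a statement about `T` alone: complete reducibility holds exactly when `T`
kills the off-diagonal blocks of all its invariant projections.

If `T` is completely reducible with components `U_i`, then for each `i` either `T` vanishes on
`U_i M U_i`, or `U_i` lies below `W` or below `1 - W` (`IsIrreducibleOn.map_eq_zero_or_mul_eq_zero`),
so `T (W X (1 - W)) = ∑ i, T (U_i W X (1 - W) U_i) = 0`. In the other direction, an invariant
projection that is not irreducible splits as the sum of two smaller invariant ones without cross
terms, and induction starting from the identity produces the components
(`exists_irreducible_decomposition`).

Everything rests on two facts about positivity: a positive semidefinite `A` is comparable, up to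
positive scalars, with its range projection (`Matrix.PosSemidef.exists_support`), and consequently a
positive map is controlled on `W M W` by its value at `W` (`map_mem_corner`).
-/

/-! ### Positive semidefinite matrices and projections -/

section PosSemidef
variable {n : Type*} [Fintype n]

theorem IsStarProjection.posSemidef {W : Matrix n n ℂ} (hW : IsStarProjection W) :
    W.PosSemidef := by
  have h := Matrix.posSemidef_conjTranspose_mul_self W
  rwa [← Matrix.star_eq_conjTranspose, hW.isSelfAdjoint.star_eq, hW.isIdempotentElem.eq] at h

theorem IsStarProjection.conjTranspose_eq {W : Matrix n n ℂ} (hW : IsStarProjection W) :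
    Wᴴ = W := hW.isSelfAdjoint.star_eq

theorem Matrix.PosSemidef.compress {A W : Matrix n n ℂ} (hA : A.PosSemidef)
    (hW : IsStarProjection W) : (W * A * W).PosSemidef := by
  simpa only [hW.conjTranspose_eq] using hA.conjTranspose_mul_mul_same W

theorem trace_compress (A : Matrix n n ℂ) {W : Matrix n n ℂ} (hW : IsStarProjection W) :
    (W * A * W).trace = (A * W).trace := by
  rw [Matrix.mul_assoc, Matrix.trace_mul_comm, Matrix.mul_assoc, hW.isIdempotentElem.eq]

theorem Matrix.PosSemidef.trace_mul_projection_nonneg {A W : Matrix n n ℂ} (hA : A.PosSemidef)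
    (hW : IsStarProjection W) : 0 ≤ (A * W).trace :=
  trace_compress A hW ▸ (hA.compress hW).trace_nonneg

theorem Matrix.PosSemidef.trace_mul_nonneg {A B : Matrix n n ℂ} (hA : A.PosSemidef)
    (hB : B.PosSemidef) : 0 ≤ (A * B).trace := by
  obtain ⟨C, rfl⟩ : ∃ C : Matrix n n ℂ, B = Cᴴ * C := by
    classical open scoped MatrixOrder in
    exact CStarAlgebra.nonneg_iff_eq_star_mul_self.mp hB.nonneg
  rw [← Matrix.mul_assoc, Matrix.trace_mul_comm, ← Matrix.mul_assoc]
  exact (hA.mul_mul_conjTranspose_same C).trace_nonneg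

/-- A positive semidefinite matrix with `tr (A W) = 0` annihilates the range of `W`. -/
theorem Matrix.PosSemidef.mul_projection_eq_zero {A W : Matrix n n ℂ} (hA : A.PosSemidef)
    (hW : IsStarProjection W) (h : (A * W).trace = 0) : A * W = 0 := by
  obtain ⟨C, rfl⟩ : ∃ C : Matrix n n ℂ, A = Cᴴ * C := by
    classical open scoped MatrixOrder in
    exact CStarAlgebra.nonneg_iff_eq_star_mul_self.mp hA.nonneg
  rw [← trace_compress _ hW] at h
  have h2 : ((C * W)ᴴ * (C * W)).trace = 0 := by
    rw [← h, Matrix.conjTranspose_mul, hW.conjTranspose_eq]; simp only [Matrix.mul_assoc]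
  rw [Matrix.trace_conjTranspose_mul_self_eq_zero_iff] at h2
  rw [Matrix.mul_assoc, h2, Matrix.mul_zero]

variable [DecidableEq n]

/-- The projection `P` onto the range of a positive semidefinite matrix `A`, with the comparison
`P ≤ c A` and `A ≤ d P`. -/
theorem Matrix.PosSemidef.exists_support {A : Matrix n n ℂ} (hA : A.PosSemidef) :
    ∃ (P C : Matrix n n ℂ) (c d : ℝ), IsStarProjection P ∧ P * A = A ∧ P = A * C ∧
      0 ≤ c ∧ 0 ≤ d ∧ ((c : ℂ) • A - P).PosSemidef ∧ ((d : ℂ) • P - A).PosSemidef := by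
  set U : Matrix n n ℂ := (hA.1.eigenvectorUnitary : Matrix n n ℂ) with hU
  have hUU : star U * U = 1 := Unitary.coe_star_mul_self _
  set e := hA.1.eigenvalues with he
  have he0 : ∀ i, 0 ≤ e i := hA.eigenvalues_nonneg
  have hAe : A = U * Matrix.diagonal (fun i => (e i : ℂ)) * star U := by
    conv_lhs => rw [hA.1.spectral_theorem, Unitary.conjStarAlgAut_apply]
    rfl
  have hmul : ∀ f g : n → ℂ, U * Matrix.diagonal f * star U * (U * Matrix.diagonal g * star U)
      = U * Matrix.diagonal (fun i => f i * g i) * star U := by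
    intro f g
    rw [← Matrix.diagonal_mul_diagonal]
    calc _ = U * Matrix.diagonal f * (star U * U) * Matrix.diagonal g * star U := by
          simp only [Matrix.mul_assoc]
      _ = _ := by rw [hUU, Matrix.mul_one]; simp only [Matrix.mul_assoc]
  have hpos : ∀ f : n → ℂ, (∀ i, 0 ≤ f i) → (U * Matrix.diagonal f * star U).PosSemidef :=
    fun f hf => (Matrix.PosSemidef.diagonal (fun i => hf i)).mul_mul_conjTranspose_same U
  have hsmul : ∀ (c : ℂ) (f g : n → ℂ), c • (U * Matrix.diagonal f * star U)
      - U * Matrix.diagonal g * star U = U * Matrix.diagonal (fun i => c * f i - g i) * star U := by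
    intro c f g
    rw [← Matrix.diagonal_sub, mul_sub, sub_mul]
    congr 1
    rw [← Matrix.smul_mul, ← Matrix.mul_smul]
    congr 2
    ext i j
    simp [Matrix.diagonal_apply]
  have hsum : ∀ (f : n → ℝ), (∀ i, 0 ≤ f i) → ∀ i, f i ≤ ∑ j, f j :=
    fun f hf i => Finset.single_le_sum (fun j _ => hf j) (Finset.mem_univ i)
  refine ⟨U * Matrix.diagonal (fun i => if e i = 0 then 0 else 1) * star U,
    U * Matrix.diagonal (fun i => ((e i)⁻¹ : ℂ)) * star U, ∑ i, (e i)⁻¹, ∑ i, e i,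
    ⟨?_, ?_⟩, ?_, ?_, Finset.sum_nonneg fun i _ => inv_nonneg.2 (he0 i),
    Finset.sum_nonneg fun i _ => he0 i, ?_, ?_⟩
  · rw [IsIdempotentElem, hmul]
    congr 3
    ext i
    split_ifs <;> simp
  · refine (hpos _ fun i => ?_).1
    split_ifs <;> simp
  · rw [hAe, hmul]
    congr 3
    ext i
    split_ifs with h <;> simp [h]
  · conv_rhs => rw [hAe]
    rw [hmul]
    congr 3
    ext i
    split_ifs with h <;> simp [h]
  · rw [hAe, hsmul]
    refine hpos _ fun i => ?_
    split_ifs with h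
    · simp [h]
    · have h1 := hsum (fun i => (e i)⁻¹) (fun i => inv_nonneg.2 (he0 i)) i
      have h2 := mul_le_mul_of_nonneg_right h1 (he0 i)
      rw [inv_mul_cancel₀ h] at h2
      rw [← Complex.ofReal_mul, sub_nonneg]
      exact_mod_cast h2
  · rw [hAe, hsmul]
    refine hpos _ fun i => ?_
    split_ifs with h
    · simp [h]
    · rw [mul_one, sub_nonneg]
      exact_mod_cast hsum e he0 i

end PosSemidef

/-! ### Corner algebras and positive maps -/

section Corner
variable {n : ℕ}

theorem mem_corner_iff {V X : Matrix (Fin n) (Fin n) ℂ} (hV : IsIdempotentElem V) :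
    X ∈ corner V ↔ V * X * V = X := by
  refine ⟨?_, fun h => ⟨X, h.symm⟩⟩
  rintro ⟨Y, rfl⟩
  rw [← Matrix.mul_assoc, ← Matrix.mul_assoc, hV.eq, Matrix.mul_assoc (V * Y), hV.eq]

theorem mem_corner_iff_mul {V X : Matrix (Fin n) (Fin n) ℂ} (hV : IsIdempotentElem V) :
    X ∈ corner V ↔ V * X = X ∧ X * V = X := by
  rw [mem_corner_iff hV]
  constructor
  · intro h
    constructor
    · rw [← h, ← Matrix.mul_assoc, ← Matrix.mul_assoc, hV.eq]
    · rw [← h, Matrix.mul_assoc, hV.eq]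
  · rintro ⟨h1, h2⟩
    rw [h1, h2]

theorem self_mem_corner {V : Matrix (Fin n) (Fin n) ℂ} (hV : IsIdempotentElem V) :
    V ∈ corner V := (mem_corner_iff_mul hV).2 ⟨hV.eq, hV.eq⟩

theorem Matrix.IsHermitian.mem_corner_iff_mul_eq {A V : Matrix (Fin n) (Fin n) ℂ}
    (hA : A.IsHermitian) (hV : IsStarProjection V) : A ∈ corner V ↔ A * V = A := by
  rw [mem_corner_iff_mul hV.isIdempotentElem, and_iff_right_of_imp]
  intro h
  have := congrArg Matrix.conjTranspose h
  rwa [Matrix.conjTranspose_mul, hA.eq, hV.conjTranspose_eq] at this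

/-- For a positive semidefinite matrix, membership in `V M_n V` is a trace condition. -/
theorem Matrix.PosSemidef.mem_corner_iff_trace {A V : Matrix (Fin n) (Fin n) ℂ}
    (hA : A.PosSemidef) (hV : IsStarProjection V) :
    A ∈ corner V ↔ (A * (1 - V)).trace = 0 := by
  rw [hA.1.mem_corner_iff_mul_eq hV]
  constructor
  · intro h
    rw [mul_sub, mul_one, h, sub_self, Matrix.trace_zero]
  · intro h
    have := hA.mul_projection_eq_zero hV.one_sub h
    rw [mul_sub, mul_one, sub_eq_zero] at this
    exact this.symm

theorem Matrix.PosSemidef.mem_corner_of_le {A B V : Matrix (Fin n) (Fin n) ℂ}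
    (hA : A.PosSemidef) (hBA : (B - A).PosSemidef) (hV : IsStarProjection V)
    (hB : B ∈ corner V) : A ∈ corner V := by
  rw [hA.mem_corner_iff_trace hV]
  have hB' : B.PosSemidef := by simpa using hBA.add hA
  rw [hB'.mem_corner_iff_trace hV] at hB
  have h1 := hA.trace_mul_projection_nonneg hV.one_sub
  have h2 := hBA.trace_mul_projection_nonneg hV.one_sub
  rw [sub_mul, Matrix.trace_sub, hB, zero_sub, Left.nonneg_neg_iff] at h2
  exact le_antisymm h2 h1

theorem corner_le_corner {V W : Matrix (Fin n) (Fin n) ℂ} (hV : IsIdempotentElem V)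
    (h : W ∈ corner V) : corner W ≤ corner V := by
  rw [mem_corner_iff_mul hV] at h
  rintro _ ⟨X, rfl⟩
  rw [mem_corner_iff_mul hV]
  constructor
  · rw [← Matrix.mul_assoc, ← Matrix.mul_assoc, h.1]
  · rw [Matrix.mul_assoc, h.2]

/-- Polarization: every matrix is a combination of four matrices of the form `Cᴴ C`. -/
theorem Matrix.eq_sum_conjTranspose_mul_self (X : Matrix (Fin n) (Fin n) ℂ) :
    X = (1 / 4 : ℂ) • ((1 + X)ᴴ * (1 + X)) - (1 / 4 : ℂ) • ((1 - X)ᴴ * (1 - X))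
      - (Complex.I / 4) • ((1 + Complex.I • X)ᴴ * (1 + Complex.I • X))
      + (Complex.I / 4) • ((1 - Complex.I • X)ᴴ * (1 - Complex.I • X)) := by
  simp only [Matrix.conjTranspose_add, Matrix.conjTranspose_sub, Matrix.conjTranspose_smul,
    Matrix.conjTranspose_one, mul_add, add_mul, mul_sub, sub_mul, mul_one, one_mul,
    Matrix.smul_mul, Matrix.mul_smul, Complex.star_def, Complex.conj_I]
  match_scalars <;> ring_nf <;> simp [Complex.I_sq]
  ring

/-- A positive map sends `W M W` into `E M E` as soon as it sends `W` there. -/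
theorem map_mem_corner {k m : ℕ} {S : Matrix (Fin k) (Fin k) ℂ →ₗ[ℂ] Matrix (Fin m) (Fin m) ℂ}
    (hS : ∀ X, X.PosSemidef → (S X).PosSemidef) {W : Matrix (Fin k) (Fin k) ℂ}
    {E : Matrix (Fin m) (Fin m) ℂ} (hW : IsStarProjection W) (hE : IsStarProjection E)
    (h : S W ∈ corner E) {X : Matrix (Fin k) (Fin k) ℂ} (hX : X ∈ corner W) : S X ∈ corner E := by
  have key : ∀ Y : Matrix (Fin k) (Fin k) ℂ, Y.PosSemidef → S (W * Y * W) ∈ corner E := by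
    intro Y hY
    obtain ⟨P, C, c, d, hP, hPY, -, -, hd, -, hdP⟩ := hY.exists_support
    -- `Y ≤ d P ≤ d`, so the compression of `Y` to `W` is at most `d W`.
    have h1 : ((d : ℂ) • (1 : Matrix (Fin k) (Fin k) ℂ) - Y).PosSemidef := by
      have := (hP.one_sub.posSemidef.smul (a := (d : ℂ)) (by exact_mod_cast hd)).add hdP
      rwa [smul_sub, sub_add_sub_cancel] at this
    have h2 := h1.compress hW
    rw [mul_sub, sub_mul, Matrix.mul_smul, Matrix.smul_mul, mul_one, hW.isIdempotentElem.eq] at h2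
    have h3 := hS _ h2
    rw [map_sub, map_smul] at h3
    exact (hS _ (hY.compress hW)).mem_corner_of_le h3 hE ((corner E).smul_mem _ h)
  obtain ⟨Y, rfl⟩ := hX
  let L := S ∘ₗ LinearMap.mulRight ℂ W ∘ₗ LinearMap.mulLeft ℂ W
  have hL : ∀ C : Matrix (Fin k) (Fin k) ℂ, L (Cᴴ * C) ∈ corner E := fun C =>
    key _ (Matrix.posSemidef_conjTranspose_mul_self C)
  change L Y ∈ corner E
  rw [Y.eq_sum_conjTranspose_mul_self]
  simp only [map_add, map_sub, map_smul]
  exact add_mem (sub_mem (sub_mem ((corner E).smul_mem _ (hL _)) ((corner E).smul_mem _ (hL _)))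
    ((corner E).smul_mem _ (hL _))) ((corner E).smul_mem _ (hL _))

end Corner

/-! ### The maps of a state -/

section StateMaps
variable {k m : ℕ} {γ : Matrix (Fin k × Fin m) (Fin k × Fin m) ℂ}

theorem trace_mul_kronecker_eq_mapG (γ : Matrix (Fin k × Fin m) (Fin k × Fin m) ℂ)
    (X : Matrix (Fin k) (Fin k) ℂ) (Y : Matrix (Fin m) (Fin m) ℂ) :
    (γ * (X ⊗ₖ Y)).trace = (mapG γ X * Y).trace := by
  simp only [mapG, LinearMap.coe_mk, AddHom.coe_mk, Matrix.of_apply, Matrix.trace,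
    Matrix.diag_apply, Matrix.mul_apply, Matrix.kroneckerMap_apply, Fintype.sum_prod_type,
    Finset.sum_mul]
  rw [Finset.sum_comm]
  refine Finset.sum_congr rfl fun i _ => ?_
  conv_rhs => rw [Finset.sum_comm]
  refine Finset.sum_congr rfl fun a _ => ?_
  rw [Finset.sum_comm]
  exact Finset.sum_congr rfl fun j _ => Finset.sum_congr rfl fun b _ => by ring

theorem trace_mul_kronecker_eq_mapF (γ : Matrix (Fin k × Fin m) (Fin k × Fin m) ℂ)
    (X : Matrix (Fin k) (Fin k) ℂ) (Y : Matrix (Fin m) (Fin m) ℂ) :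
    (γ * (X ⊗ₖ Y)).trace = (mapF γ Y * X).trace := by
  simp only [mapF, LinearMap.coe_mk, AddHom.coe_mk, Matrix.of_apply, Matrix.trace,
    Matrix.diag_apply, Matrix.mul_apply, Matrix.kroneckerMap_apply, Fintype.sum_prod_type,
    Finset.sum_mul]
  refine Finset.sum_congr rfl fun a _ => ?_
  rw [Finset.sum_comm]
  exact Finset.sum_congr rfl fun b _ => Finset.sum_congr rfl fun i _ =>
    Finset.sum_congr rfl fun j _ => by ring

theorem mapF_eq_mapG_swap (γ : Matrix (Fin k × Fin m) (Fin k × Fin m) ℂ) :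
    mapF γ = mapG (γ.submatrix Prod.swap Prod.swap) := rfl

theorem mapG_conjTranspose (hγ : γ.IsHermitian) (X : Matrix (Fin k) (Fin k) ℂ) :
    mapG γ Xᴴ = (mapG γ X)ᴴ := by
  ext i j
  simp only [mapG, LinearMap.coe_mk, AddHom.coe_mk, Matrix.of_apply, Matrix.conjTranspose_apply,
    star_sum, star_mul']
  rw [Finset.sum_comm]
  refine Finset.sum_congr rfl fun a _ => Finset.sum_congr rfl fun b _ => ?_
  rw [hγ.apply]

theorem mapF_conjTranspose (hγ : γ.IsHermitian) (Y : Matrix (Fin m) (Fin m) ℂ) :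
    mapF γ Yᴴ = (mapF γ Y)ᴴ := by
  rw [mapF_eq_mapG_swap, mapG_conjTranspose (hγ.submatrix _)]

theorem mapG_posSemidef (hγ : γ.PosSemidef) {X : Matrix (Fin k) (Fin k) ℂ} (hX : X.PosSemidef) :
    (mapG γ X).PosSemidef := by
  refine Matrix.PosSemidef.of_dotProduct_mulVec_nonneg ?_ fun x => ?_
  · rw [Matrix.IsHermitian, ← mapG_conjTranspose hγ.1, hX.1.eq]
  · have h := hγ.trace_mul_nonneg (hX.kronecker (Matrix.posSemidef_vecMulVec_self_star x))
    rwa [trace_mul_kronecker_eq_mapG, Matrix.mul_vecMulVec, Matrix.trace_vecMulVec,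
      dotProduct_comm] at h

theorem mapF_posSemidef (hγ : γ.PosSemidef) {Y : Matrix (Fin m) (Fin m) ℂ} (hY : Y.PosSemidef) :
    (mapF γ Y).PosSemidef := by
  rw [mapF_eq_mapG_swap]
  exact mapG_posSemidef (hγ.submatrix _) hY

theorem isPositiveMap_mapF_comp_mapG (hγ : γ.PosSemidef) :
    IsPositiveMap (mapF γ ∘ₗ mapG γ) :=
  fun _ hX => mapF_posSemidef hγ (mapG_posSemidef hγ hX)

/-- `F_γ` and `G_γ` are adjoint to each other for the bilinear trace form. -/
theorem trace_mapF_mul (γ : Matrix (Fin k × Fin m) (Fin k × Fin m) ℂ)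
    (X : Matrix (Fin k) (Fin k) ℂ) (Y : Matrix (Fin m) (Fin m) ℂ) :
    (mapF γ Y * X).trace = (mapG γ X * Y).trace := by
  rw [← trace_mul_kronecker_eq_mapF, trace_mul_kronecker_eq_mapG]

theorem isTraceSelfAdjoint_mapF_comp_mapG (hγ : γ.IsHermitian) :
    IsTraceSelfAdjoint (mapF γ ∘ₗ mapG γ) := by
  intro X Y
  simp only [LinearMap.comp_apply]
  rw [trace_mapF_mul, Matrix.trace_mul_comm X, ← mapF_conjTranspose hγ, trace_mapF_mul,
    Matrix.trace_mul_comm, mapG_conjTranspose hγ]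

theorem mapG_eq_zero_of_comp (hγ : γ.IsHermitian) {X : Matrix (Fin k) (Fin k) ℂ}
    (h : mapF γ (mapG γ X) = 0) : mapG γ X = 0 := by
  rw [← Matrix.trace_mul_conjTranspose_self_eq_zero_iff, ← trace_mapF_mul,
    mapF_conjTranspose hγ, h, Matrix.conjTranspose_zero, Matrix.zero_mul, Matrix.trace_zero]

/-- Product matrices separate the points of `M_k ⊗ M_m` in the trace pairing. -/
theorem eq_zero_of_trace_mul_kronecker {N : Matrix (Fin k × Fin m) (Fin k × Fin m) ℂ}
    (h : ∀ (X : Matrix (Fin k) (Fin k) ℂ) (Y : Matrix (Fin m) (Fin m) ℂ),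
      (N * (X ⊗ₖ Y)).trace = 0) : N = 0 := by
  ext ⟨a, i⟩ ⟨b, j⟩
  have := h (Matrix.single b a 1) (Matrix.single j i 1)
  rw [Matrix.single_kronecker_single] at this
  simpa [Matrix.trace_mul_single] using this

theorem comp_mem_corner_of_trace_eq_zero (hγ : γ.PosSemidef) {W : Matrix (Fin k) (Fin k) ℂ}
    {V : Matrix (Fin m) (Fin m) ℂ} (hW : IsStarProjection W) (hV : IsStarProjection V)
    (h₁ : (γ * (W ⊗ₖ (1 - V))).trace = 0) (h₂ : (γ * ((1 - W) ⊗ₖ V)).trace = 0) :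
    mapF γ (mapG γ W) ∈ corner W := by
  rw [trace_mul_kronecker_eq_mapG,
    ← (mapG_posSemidef hγ hW.posSemidef).mem_corner_iff_trace hV] at h₁
  rw [trace_mul_kronecker_eq_mapF,
    ← (mapF_posSemidef hγ hV.posSemidef).mem_corner_iff_trace hW] at h₂
  exact map_mem_corner (fun _ => mapF_posSemidef hγ) hV hW h₂ h₁

/-- A projection `W` invariant under `F_γ ∘ G_γ` has a partner in the second factor: the
projection onto the range of `G_γ(W)`. -/
theorem exists_projection_trace_eq_zero (hγ : γ.PosSemidef) {W : Matrix (Fin k) (Fin k) ℂ}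
    (hW : IsStarProjection W) (h : mapF γ (mapG γ W) ∈ corner W) :
    ∃ V : Matrix (Fin m) (Fin m) ℂ, IsStarProjection V ∧
      (γ * (W ⊗ₖ (1 - V))).trace = 0 ∧ (γ * ((1 - W) ⊗ₖ V)).trace = 0 := by
  have hG := mapG_posSemidef hγ hW.posSemidef
  obtain ⟨V, -, c, -, hV, hVG, -, -, -, hc, -⟩ := hG.exists_support
  refine ⟨V, hV, ?_, ?_⟩
  · rw [trace_mul_kronecker_eq_mapG, Matrix.trace_mul_comm, sub_mul, one_mul, hVG, sub_self,
      Matrix.trace_zero]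
  · rw [trace_mul_kronecker_eq_mapF,
      ← (mapF_posSemidef hγ hV.posSemidef).mem_corner_iff_trace hW]
    have h1 := mapF_posSemidef hγ hc
    rw [map_sub, map_smul] at h1
    exact (mapF_posSemidef hγ hV.posSemidef).mem_corner_of_le h1 hW ((corner W).smul_mem _ h)

end StateMaps

/-! ### Irreducible components and off-diagonal blocks -/

section Reducibility
variable {n : ℕ}

theorem IsPositiveMap.leavesInvariant
    {T : Matrix (Fin n) (Fin n) ℂ →ₗ[ℂ] Matrix (Fin n) (Fin n) ℂ} (hT : IsPositiveMap T)
    {W : Matrix (Fin n) (Fin n) ℂ} (hW : IsStarProjection W) (h : T W ∈ corner W) :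
    LeavesInvariant T W := fun _ hX => map_mem_corner hT hW hW h hX

theorem eq_of_corner_eq {V W : Matrix (Fin n) (Fin n) ℂ} (hV : IsIdempotentElem V)
    (hW : IsIdempotentElem W) (h : corner W = corner V) : W = V := by
  have h1 := (mem_corner_iff_mul hV).1 (h ▸ self_mem_corner hW)
  have h2 := (mem_corner_iff_mul hW).1 (h ▸ self_mem_corner hV)
  exact h1.1.symm.trans h2.2

theorem isStarProjection_sub {V W : Matrix (Fin n) (Fin n) ℂ} (hV : IsStarProjection V)
    (hW : IsStarProjection W) (h : W ∈ corner V) : IsStarProjection (V - W) :=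
  hW.sub_of_mul_eq_left hV ((mem_corner_iff_mul hV.isIdempotentElem).1 h).2

theorem mem_corner_one_sub_iff {W X : Matrix (Fin n) (Fin n) ℂ} (hW : IsIdempotentElem W) :
    X ∈ corner (1 - W) ↔ W * X = 0 ∧ X * W = 0 := by
  rw [mem_corner_iff_mul hW.one_sub, sub_mul, one_mul, sub_eq_self, mul_sub, mul_one, sub_eq_self]

/-- If `T` is irreducible on `U M_n U` and maps the compressions to `U` of `W` and of `1 - W` into
`W M_n W` and `(1 - W) M_n (1 - W)`, then `T` vanishes on `U M_n U` or `U` lies below `W` or below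
`1 - W`. Indeed the range of `T U` is invariant, hence is all of `U` when it is nonzero; as `T U`
commutes with `W`, so does `U`, and `U W` is an invariant projection below `U`. -/
theorem IsIrreducibleOn.map_eq_zero_or_mul_eq_zero
    {T : Matrix (Fin n) (Fin n) ℂ →ₗ[ℂ] Matrix (Fin n) (Fin n) ℂ} (hT : IsPositiveMap T)
    {U W : Matrix (Fin n) (Fin n) ℂ} (hU : IsStarProjection U) (hW : IsStarProjection W)
    (hTU : T U ∈ corner U) (hirr : IsIrreducibleOn T U) (hA : T (U * W * U) ∈ corner W)
    (hB : T (U * (1 - W) * U) ∈ corner (1 - W)) :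
    T U = 0 ∨ U * W = 0 ∨ U * (1 - W) = 0 := by
  have hTUpos := hT U hU.posSemidef
  obtain ⟨P, C, c, -, hP, hPT, hPC, -, -, hc, -⟩ := hTUpos.exists_support
  have hTUP : T U ∈ corner P := by
    rw [hTUpos.1.mem_corner_iff_mul_eq hP]
    simpa [hTUpos.1.eq, hP.conjTranspose_eq] using congrArg Matrix.conjTranspose hPT
  have hPU : P ∈ corner U :=
    hP.posSemidef.mem_corner_of_le hc hU ((corner U).smul_mem _ hTU)
  have hTP : T P ∈ corner P := by
    have h1 := hT _ (isStarProjection_sub hU hP hPU).posSemidef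
    rw [map_sub] at h1
    exact (hT _ hP.posSemidef).mem_corner_of_le h1 hP hTUP
  rcases hirr P hP (corner_le_corner hU.isIdempotentElem hPU) (hT.leavesInvariant hP hTP) with
    rfl | rfl
  · left
    rw [← hPT, Matrix.zero_mul]
  right
  have hPW : W * T P = T P * W := by
    have hsplit : P = P * W * P + P * (1 - W) * P := by
      rw [mul_sub, sub_mul, mul_one, hP.isIdempotentElem.eq, add_sub_cancel]
    have hA' := (mem_corner_iff_mul hW.isIdempotentElem).1 hA
    have hB' := (mem_corner_one_sub_iff hW.isIdempotentElem).1 hB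
    have : T P = T (P * W * P) + T (P * (1 - W) * P) := by rw [← map_add, ← hsplit]
    rw [this, mul_add, add_mul, hA'.1, hA'.2, hB'.1, hB'.2]
  -- `P = T P * C` factors through `T P`, so `P` inherits the commutation with `W`.
  have h1 : P * (W * P) = W * P := by
    calc P * (W * P) = P * (W * (T P * C)) := by rw [← hPC]
      _ = P * T P * W * C := by rw [← Matrix.mul_assoc W, hPW]; simp only [Matrix.mul_assoc]
      _ = W * (T P * C) := by rw [hPT, ← hPW, Matrix.mul_assoc]
      _ = W * P := by rw [← hPC]
  have h2 : P * W * P = P * W := by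
    simpa [hP.conjTranspose_eq, hW.conjTranspose_eq] using congrArg Matrix.conjTranspose h1
  have hcomm : P * W = W * P := by rw [← h2, Matrix.mul_assoc, h1]
  have hQ : IsStarProjection (P * W) := hP.mul hW hcomm
  have hTQ : T (P * W) ∈ corner (P * W) := by
    have hQP := hT.leavesInvariant hP hTP _ ⟨W, rfl⟩
    rw [mem_corner_iff_mul hP.isIdempotentElem] at hQP
    have hQW := (mem_corner_iff_mul hW.isIdempotentElem).1 hA
    rw [h2] at hQP hQW
    rw [mem_corner_iff_mul hQ.isIdempotentElem]
    exact ⟨by rw [Matrix.mul_assoc, hQW.1, hQP.1],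
      by rw [← Matrix.mul_assoc, hQP.2, hQW.2]⟩
  rcases hirr (P * W) hQ (corner_le_corner hP.isIdempotentElem ⟨W, h2.symm⟩)
    (hT.leavesInvariant hQ hTQ) with h | h
  · exact Or.inl h
  · exact Or.inr (by rw [mul_sub, mul_one, h, sub_self])

section Orthogonal
variable {ι : Type*} {U : ι → Matrix (Fin n) (Fin n) ℂ}

theorem sub_sum_mem_traceOrthogonal [Fintype ι] (hU : ∀ i, IsStarProjection (U i))
    (hUU : ∀ i j, i ≠ j → U i * U j = 0) (X : Matrix (Fin n) (Fin n) ℂ) :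
    X - ∑ i, U i * X * U i ∈ traceOrthogonal (⨆ i, corner (U i)) := by
  intro Z hZ
  induction hZ using Submodule.iSup_induction' with
  | mem i Z hZ =>
    obtain ⟨Y, rfl⟩ := hZ
    have h0 : U i * (X - ∑ j, U j * X * U j) * U i = 0 := by
      rw [mul_sub, sub_mul, Finset.mul_sum, Finset.sum_mul, Finset.sum_eq_single i]
      · rw [(mem_corner_iff (hU i).isIdempotentElem).1 ⟨X, rfl⟩, sub_self]
      · intro j _ hj
        rw [← Matrix.mul_assoc, ← Matrix.mul_assoc, hUU i j hj.symm]
        simp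
      · simp
    rw [Matrix.conjTranspose_mul, Matrix.conjTranspose_mul, (hU i).conjTranspose_eq,
      ← Matrix.mul_assoc, ← Matrix.mul_assoc, Matrix.trace_mul_comm, ← Matrix.mul_assoc,
      ← Matrix.mul_assoc, h0, Matrix.zero_mul, Matrix.trace_zero]
  | zero => simp
  | add Z Z' _ _ h h' => rw [Matrix.conjTranspose_add, mul_add, Matrix.trace_add, h, h', add_zero]

theorem compress_eq_zero_of_mem_traceOrthogonal (hU : ∀ i, IsStarProjection (U i))
    {X : Matrix (Fin n) (Fin n) ℂ} (hX : X ∈ traceOrthogonal (⨆ i, corner (U i))) (i : ι) :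
    U i * X * U i = 0 := by
  have h := hX (U i * X * U i) (Submodule.mem_iSup_of_mem i ⟨X, rfl⟩)
  rw [← Matrix.trace_mul_conjTranspose_self_eq_zero_iff, ← h]
  have hi := (hU i).isIdempotentElem.eq
  calc (U i * X * U i * (U i * X * U i)ᴴ).trace
      = (U i * (X * U i * (U i * (Xᴴ * U i)))).trace := by
        simp only [Matrix.conjTranspose_mul, (hU i).conjTranspose_eq, Matrix.mul_assoc]
    _ = (X * (U i * U i) * Xᴴ * (U i * U i)).trace := by
        rw [Matrix.trace_mul_comm]; simp only [Matrix.mul_assoc]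
    _ = (X * (U i * X * U i)ᴴ).trace := by
        rw [hi]; simp only [Matrix.conjTranspose_mul, (hU i).conjTranspose_eq, Matrix.mul_assoc]

theorem isCompl_traceOrthogonal [Fintype ι] (hU : ∀ i, IsStarProjection (U i))
    (hUU : ∀ i j, i ≠ j → U i * U j = 0) :
    IsCompl (⨆ i, corner (U i)) (traceOrthogonal (⨆ i, corner (U i))) := by
  constructor
  · rw [Submodule.disjoint_def]
    exact fun X hX hX' => Matrix.trace_mul_conjTranspose_self_eq_zero_iff.1 (hX' X hX)
  · rw [codisjoint_iff, Submodule.eq_top_iff']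
    intro X
    rw [← add_sub_cancel (∑ i, U i * X * U i) X]
    exact Submodule.add_mem_sup
      (Submodule.sum_mem _ fun i _ => Submodule.mem_iSup_of_mem i ⟨X, rfl⟩)
      (sub_sum_mem_traceOrthogonal hU hUU X)

theorem iSupIndep_corner (hU : ∀ i, IsStarProjection (U i))
    (hUU : ∀ i j, i ≠ j → U i * U j = 0) : iSupIndep fun i => corner (U i) := by
  intro i
  rw [Submodule.disjoint_def]
  intro X hX hX'
  have hle : ⨆ (j) (_ : j ≠ i), corner (U j) ≤
      LinearMap.ker (LinearMap.mulLeft ℂ (U i)) := by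
    refine iSup₂_le fun j hj => ?_
    rintro _ ⟨Y, rfl⟩
    simp [← Matrix.mul_assoc, hUU i j hj.symm]
  rw [← ((mem_corner_iff_mul (hU i).isIdempotentElem).1 hX).1]
  simpa using hle hX'

end Orthogonal

/-- If `T` kills the off-diagonal blocks of every invariant projection and leaves the complementary
projections invariant, every invariant projection
`V` splits into irreducible ones that carry all of `T` on `V M_n V`. -/
theorem exists_irreducible_decomposition
    {T : Matrix (Fin n) (Fin n) ℂ →ₗ[ℂ] Matrix (Fin n) (Fin n) ℂ} (hT : IsPositiveMap T)
    (hcross : ∀ W, IsStarProjection W → T W ∈ corner W → T (1 - W) ∈ corner (1 - W) ∧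
      ∀ X, T (W * X * (1 - W)) = 0 ∧ T ((1 - W) * X * W) = 0)
    (V : Matrix (Fin n) (Fin n) ℂ) (hV : IsStarProjection V) (hTV : T V ∈ corner V) :
    ∃ (ι : Type) (_ : Fintype ι) (U : ι → Matrix (Fin n) (Fin n) ℂ),
      (∀ i, IsStarProjection (U i)) ∧ (∀ i j, i ≠ j → U i * U j = 0) ∧ (∀ i, U i ∈ corner V) ∧
      (∀ i, LeavesInvariant T (U i)) ∧ (∀ i, IsIrreducibleOn T (U i)) ∧
      ∀ X, T (V * X * V) = ∑ i, T (U i * X * U i) := by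
  induction hS : corner V using WellFoundedLT.induction generalizing V with
  | ind S ih =>
  subst hS
  by_cases hirr : IsIrreducibleOn T V
  · exact ⟨Unit, inferInstance, fun _ => V, fun _ => hV, fun i j h => (h rfl).elim,
      fun _ => self_mem_corner hV.isIdempotentElem, fun _ => hT.leavesInvariant hV hTV,
      fun _ => hirr, by simp⟩
  simp only [IsIrreducibleOn, not_forall, not_or] at hirr
  obtain ⟨W, hW, hWV, hinv, hW0, hW1⟩ := hirr
  have hWmem : W ∈ corner V := hWV (self_mem_corner hW.isIdempotentElem)
  have hTW : T W ∈ corner W := hinv W (self_mem_corner hW.isIdempotentElem)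
  obtain ⟨hTW', hX⟩ := hcross W hW hTW
  have hWV' := (mem_corner_iff_mul hV.isIdempotentElem).1 hWmem
  have hD := isStarProjection_sub hV hW hWmem
  have hDV : V - W ∈ corner V := sub_mem (self_mem_corner hV.isIdempotentElem) hWmem
  have hWD : W * (V - W) = 0 := by rw [mul_sub, hWV'.2, hW.isIdempotentElem.eq, sub_self]
  have hDW : (V - W) * W = 0 := by rw [sub_mul, hWV'.1, hW.isIdempotentElem.eq, sub_self]
  have hD1 : V - W ∈ corner (1 - W) := by
    exact (mem_corner_one_sub_iff hW.isIdempotentElem).2 ⟨hWD, hDW⟩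
  have hTD : T (V - W) ∈ corner (V - W) := by
    have h1 : T (V - W) ∈ corner (1 - W) := map_mem_corner hT hW.one_sub hW.one_sub hTW' hD1
    have h2 : T (V - W) ∈ corner V := map_mem_corner hT hV hV hTV hDV
    rw [mem_corner_one_sub_iff hW.isIdempotentElem] at h1
    rw [mem_corner_iff_mul hV.isIdempotentElem] at h2
    rw [mem_corner_iff_mul hD.isIdempotentElem, sub_mul, h1.1, h2.1, mul_sub, h1.2, h2.2, sub_zero]
    exact ⟨rfl, rfl⟩
  have hlt : corner W < corner V := lt_of_le_of_ne hWV fun h =>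
    hW1 (eq_of_corner_eq hV.isIdempotentElem hW.isIdempotentElem h)
  have hlt' : corner (V - W) < corner V :=
    lt_of_le_of_ne (corner_le_corner hV.isIdempotentElem hDV) fun h => hW0 <| by
      simpa using eq_of_corner_eq hV.isIdempotentElem hD.isIdempotentElem h
  obtain ⟨ι, _, U, hU, hUU, hUW, hUinv, hUirr, hUT⟩ := ih _ hlt W hW hTW rfl
  obtain ⟨ι', _, U', hU', hUU', hUD, hUinv', hUirr', hUT'⟩ := ih _ hlt' (V - W) hD hTD rfl
  have hUl : ∀ i j, U i * U' j = 0 := fun i j => by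
    rw [← ((mem_corner_iff_mul hW.isIdempotentElem).1 (hUW i)).2,
      ← ((mem_corner_iff_mul hD.isIdempotentElem).1 (hUD j)).1, Matrix.mul_assoc,
      ← Matrix.mul_assoc W, hWD, Matrix.zero_mul, Matrix.mul_zero]
  have hUr : ∀ i j, U' j * U i = 0 := fun i j => by
    rw [← ((mem_corner_iff_mul hW.isIdempotentElem).1 (hUW i)).1,
      ← ((mem_corner_iff_mul hD.isIdempotentElem).1 (hUD j)).2, Matrix.mul_assoc,
      ← Matrix.mul_assoc (V - W), hDW, Matrix.zero_mul, Matrix.mul_zero]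
  refine ⟨ι ⊕ ι', inferInstance, Sum.elim U U', ?_, ?_, ?_, ?_, ?_, fun X => ?_⟩
  · rintro (i | i)
    exacts [hU i, hU' i]
  · rintro (i | i) (j | j) h
    · exact hUU i j fun e => h (e ▸ rfl)
    · exact hUl i j
    · exact hUr j i
    · exact hUU' i j fun e => h (e ▸ rfl)
  · rintro (i | i)
    exacts [hWV (hUW i), hlt'.le (hUD i)]
  · rintro (i | i)
    exacts [hUinv i, hUinv' i]
  · rintro (i | i)
    exacts [hUirr i, hUirr' i]
  · rw [Fintype.sum_sum_type]
    simp only [Sum.elim_inl, Sum.elim_inr]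
    rw [← hUT, ← hUT']
    have hD2 := (mem_corner_iff_mul hW.one_sub.isIdempotentElem).1 hD1
    have e1 := (hX (X * (V - W))).1
    have e2 := (hX ((V - W) * X)).2
    rw [← Matrix.mul_assoc, Matrix.mul_assoc, hD2.2] at e1
    rw [← Matrix.mul_assoc, hD2.1] at e2
    have e : V * X * V = W * X * W + (V - W) * X * (V - W) + W * X * (V - W)
        + (V - W) * X * W := by noncomm_ring
    rw [e, map_add, map_add, map_add, e1, e2, add_zero, add_zero]

theorem IsCompletelyReducible.of_forall_invariant
    {T : Matrix (Fin n) (Fin n) ℂ →ₗ[ℂ] Matrix (Fin n) (Fin n) ℂ} (hT : IsPositiveMap T)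
    (hsa : IsTraceSelfAdjoint T)
    (hcross : ∀ W, IsStarProjection W → T W ∈ corner W → T (1 - W) ∈ corner (1 - W) ∧
      ∀ X, T (W * X * (1 - W)) = 0 ∧ T ((1 - W) * X * W) = 0) :
    IsCompletelyReducible T := by
  obtain ⟨ι, _, U, hU, hUU, -, hinv, hirr, hsum⟩ := exists_irreducible_decomposition hT hcross 1
    (.one _) ⟨T 1, by simp⟩
  let e := (Fintype.equivFin ι).symm
  have hU' : ∀ i, IsStarProjection (U (e i)) := fun i => hU _
  have hUU' : ∀ i j, i ≠ j → U (e i) * U (e j) = 0 := fun i j h => hUU _ _ (e.injective.ne h)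
  refine ⟨hT, hsa, Fintype.card ι, fun i => U (e i), hU', hUU', iSupIndep_corner hU' hUU',
    isCompl_traceOrthogonal hU' hUU', fun i => hinv _, fun i => hirr _, fun X hX => ?_⟩
  have h := hsum X
  rw [one_mul, mul_one, ← e.sum_comp] at h
  rw [h]
  refine Finset.sum_eq_zero fun i _ => ?_
  rw [compress_eq_zero_of_mem_traceOrthogonal hU' hX i, map_zero]

/-- A completely reducible map kills the off-diagonal blocks of every projection `W` such that `W`
and `1 - W` are both invariant. -/
theorem IsCompletelyReducible.map_mul_mul_one_sub
    {T : Matrix (Fin n) (Fin n) ℂ →ₗ[ℂ] Matrix (Fin n) (Fin n) ℂ} (hT : IsCompletelyReducible T)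
    {W : Matrix (Fin n) (Fin n) ℂ} (hW : IsStarProjection W) (hTW : T W ∈ corner W)
    (hTW' : T (1 - W) ∈ corner (1 - W)) (X : Matrix (Fin n) (Fin n) ℂ) :
    T (W * X * (1 - W)) = 0 := by
  obtain ⟨hpos, -, l, U, hU, hUU, -, -, hinv, hirr, hR⟩ := hT
  have hsum : ∀ X, T X = ∑ i, T (U i * X * U i) := fun X => by
    have := hR _ (sub_sum_mem_traceOrthogonal hU hUU X)
    rwa [map_sub, map_sum, sub_eq_zero] at this
  have hcomp : ∀ W : Matrix (Fin n) (Fin n) ℂ, IsStarProjection W → T W ∈ corner W →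
      ∀ i, T (U i * W * U i) ∈ corner W := by
    intro W hW hTW i
    have hp : ∀ j, (T (U j * W * U j)).PosSemidef := fun j =>
      hpos _ (hW.posSemidef.compress (hU j))
    refine (hp i).mem_corner_of_le ?_ hW hTW
    rw [hsum W, ← Finset.sum_erase_eq_sub (Finset.mem_univ i)]
    exact Matrix.posSemidef_sum _ fun j _ => hp j
  rw [hsum]
  refine Finset.sum_eq_zero fun i _ => ?_
  have hTU := hinv i _ (self_mem_corner (hU i).isIdempotentElem)
  rcases (hirr i).map_eq_zero_or_mul_eq_zero hpos (hU i) hW hTU (hcomp W hW hTW i)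
    (hcomp _ hW.one_sub hTW' i) with h | h | h
  · have := map_mem_corner hpos (hU i) (.zero _) (E := 0) (by rw [h]; exact zero_mem _)
      ⟨W * X * (1 - W), rfl⟩
    obtain ⟨Y, hY⟩ := this
    simpa using hY
  · rw [← Matrix.mul_assoc, ← Matrix.mul_assoc, h]
    simp
  · have h' : (1 - W) * U i = 0 := by
      simpa [(hU i).conjTranspose_eq, hW.conjTranspose_eq] using congrArg Matrix.conjTranspose h
    rw [Matrix.mul_assoc, Matrix.mul_assoc, h']
    simp

end Reducibility

/-! ### Block-diagonal states -/

section Blocks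
variable {k m : ℕ} {γ : Matrix (Fin k × Fin m) (Fin k × Fin m) ℂ}
  {W : Matrix (Fin k) (Fin k) ℂ} {V : Matrix (Fin m) (Fin m) ℂ}

theorem trace_mul_eq_zero_of_block_diagonal (hW : IsIdempotentElem W) (hV : IsIdempotentElem V)
    (h : γ = (W ⊗ₖ V) * γ * (W ⊗ₖ V) + ((1 - W) ⊗ₖ (1 - V)) * γ * ((1 - W) ⊗ₖ (1 - V))) :
    (γ * (W ⊗ₖ (1 - V))).trace = 0 ∧ (γ * ((1 - W) ⊗ₖ V)).trace = 0 := by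
  constructor <;> rw [h, add_mul, Matrix.mul_assoc _ (W ⊗ₖ V),
    Matrix.mul_assoc _ ((1 - W) ⊗ₖ (1 - V)), ← Matrix.mul_kronecker_mul,
    ← Matrix.mul_kronecker_mul] <;> simp [hW.mul_one_sub_self, hV.mul_one_sub_self,
      hW.one_sub_mul_self, hV.one_sub_mul_self]

/-- A block-diagonal state has `G_γ (W X (1 - W)) = 0`. -/
theorem mapG_mul_mul_one_sub_eq_zero (hW : IsIdempotentElem W)
    (h : γ = (W ⊗ₖ V) * γ * (W ⊗ₖ V) + ((1 - W) ⊗ₖ (1 - V)) * γ * ((1 - W) ⊗ₖ (1 - V)))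
    (X : Matrix (Fin k) (Fin k) ℂ) : mapG γ (W * X * (1 - W)) = 0 := by
  rw [Matrix.ext_iff_trace_mul_right]
  intro Y
  have e1 : (W ⊗ₖ V * γ * W ⊗ₖ V * (W * X * (1 - W)) ⊗ₖ Y).trace = 0 := by
    rw [Matrix.mul_assoc, Matrix.mul_assoc, Matrix.trace_mul_comm, Matrix.mul_assoc,
      ← Matrix.mul_kronecker_mul, ← Matrix.mul_kronecker_mul]
    simp [Matrix.mul_assoc, hW.one_sub_mul_self]
  have e2 : ((1 - W) ⊗ₖ (1 - V) * γ * (1 - W) ⊗ₖ (1 - V) * (W * X * (1 - W)) ⊗ₖ Y).trace = 0 := by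
    rw [Matrix.mul_assoc, ← Matrix.mul_kronecker_mul, ← Matrix.mul_assoc, ← Matrix.mul_assoc,
      hW.one_sub_mul_self]
    simp
  rw [← trace_mul_kronecker_eq_mapG, h, add_mul, Matrix.trace_add, e1, e2]
  simp

/-- If `G_γ` kills the off-diagonal blocks `(1 - W) X W`, then `γ` has no component from the range
of `(1 - W) ⊗ (1 - V)` to that of `W ⊗ V`. -/
theorem kronecker_mul_mul_kronecker_eq_zero
    (h : ∀ X, mapG γ ((1 - W) * X * W) = 0) :
    (W ⊗ₖ V) * γ * ((1 - W) ⊗ₖ (1 - V)) = 0 := by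
  refine eq_zero_of_trace_mul_kronecker fun X Y => ?_
  rw [Matrix.mul_assoc, Matrix.mul_assoc, Matrix.trace_mul_comm, Matrix.mul_assoc,
    ← Matrix.mul_kronecker_mul, ← Matrix.mul_kronecker_mul, trace_mul_kronecker_eq_mapG, h]
  simp

/-- A state with `tr (γ (W ⊗ (1 - V))) = tr (γ ((1 - W) ⊗ V)) = 0` lives on the direct sum of the
ranges of `W ⊗ V` and `(1 - W) ⊗ (1 - V)`; it is block diagonal once one off-diagonal block
vanishes. -/
theorem block_diagonal_of_trace_mul_eq_zero (hγ : γ.PosSemidef) (hW : IsStarProjection W)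
    (hV : IsStarProjection V) (h₁ : (γ * (W ⊗ₖ (1 - V))).trace = 0)
    (h₂ : (γ * ((1 - W) ⊗ₖ V)).trace = 0)
    (hoff : (W ⊗ₖ V) * γ * ((1 - W) ⊗ₖ (1 - V)) = 0) :
    γ = (W ⊗ₖ V) * γ * (W ⊗ₖ V) + ((1 - W) ⊗ₖ (1 - V)) * γ * ((1 - W) ⊗ₖ (1 - V)) := by
  have hproj : ∀ {A : Matrix (Fin k) (Fin k) ℂ} {B : Matrix (Fin m) (Fin m) ℂ},
      IsStarProjection A → IsStarProjection B → IsStarProjection (A ⊗ₖ B) := fun hA hB =>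
    ⟨by rw [IsIdempotentElem, ← Matrix.mul_kronecker_mul, hA.isIdempotentElem.eq,
        hB.isIdempotentElem.eq],
      by rw [IsSelfAdjoint, Matrix.star_eq_conjTranspose, Matrix.conjTranspose_kronecker,
        hA.conjTranspose_eq, hB.conjTranspose_eq]⟩
  have z1 := hγ.mul_projection_eq_zero (hproj hW hV.one_sub) h₁
  have z2 := hγ.mul_projection_eq_zero (hproj hW.one_sub hV) h₂
  have hP := (hproj hW hV).conjTranspose_eq
  have hQ := (hproj hW.one_sub hV.one_sub).conjTranspose_eq
  have hone : W ⊗ₖ V + (1 - W) ⊗ₖ (1 - V) + W ⊗ₖ (1 - V) + (1 - W) ⊗ₖ V = 1 := by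
    rw [add_right_comm _ _ (W ⊗ₖ (1 - V)), ← Matrix.kronecker_add, add_assoc,
      ← Matrix.kronecker_add, add_sub_cancel, sub_add_cancel, ← Matrix.add_kronecker,
      add_sub_cancel, Matrix.one_kronecker_one]
  set P := W ⊗ₖ V
  set Q := (1 - W) ⊗ₖ (1 - V)
  have hr : γ = γ * (P + Q) := by
    conv_lhs => rw [← mul_one γ, ← hone, mul_add, mul_add _ (P + Q), z1, z2, add_zero, add_zero]
  have hl : γ = (P + Q) * γ := by
    have := congrArg Matrix.conjTranspose hr
    rwa [Matrix.conjTranspose_mul, Matrix.conjTranspose_add, hP, hQ, hγ.1.eq] at this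
  have hoff' : Q * γ * P = 0 := by
    have := congrArg Matrix.conjTranspose hoff
    rwa [Matrix.conjTranspose_mul, Matrix.conjTranspose_mul, hP, hQ, hγ.1.eq,
      Matrix.conjTranspose_zero, ← Matrix.mul_assoc] at this
  calc γ = (P + Q) * γ * (P + Q) := by rw [← hl, ← hr]
    _ = P * γ * P + P * γ * Q + (Q * γ * P + Q * γ * Q) := by
      rw [add_mul, add_mul, mul_add, mul_add]
    _ = P * γ * P + Q * γ * Q := by rw [hoff, hoff', add_zero, zero_add]

end Blocks

theorem corollary2 (k m : ℕ) (γ : Matrix (Fin k × Fin m) (Fin k × Fin m) ℂ)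
    (hγ : γ.PosSemidef) :
    γ ∈ CR k m ↔
      ∀ (W : Matrix (Fin k) (Fin k) ℂ) (V : Matrix (Fin m) (Fin m) ℂ),
        IsStarProjection W → IsStarProjection V →
          (((γ * (W ⊗ₖ (1 - V))).trace = 0 ∧ (γ * ((1 - W) ⊗ₖ V)).trace = 0) ↔
            γ = (W ⊗ₖ V) * γ * (W ⊗ₖ V) +
              ((1 - W) ⊗ₖ (1 - V)) * γ * ((1 - W) ⊗ₖ (1 - V))) := by
  constructor
  · rintro ⟨-, hCR⟩ W V hW hV
    refine ⟨fun ⟨h₁, h₂⟩ => ?_,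
      trace_mul_eq_zero_of_block_diagonal hW.isIdempotentElem hV.isIdempotentElem⟩
    refine block_diagonal_of_trace_mul_eq_zero hγ hW hV h₁ h₂
      (kronecker_mul_mul_kronecker_eq_zero fun X => mapG_eq_zero_of_comp hγ.1 ?_)
    have hTW := comp_mem_corner_of_trace_eq_zero hγ hW hV h₁ h₂
    have hTW' := comp_mem_corner_of_trace_eq_zero hγ hW.one_sub hV.one_sub
      (by rwa [sub_sub_cancel]) (by rwa [sub_sub_cancel])
    have := hCR.map_mul_mul_one_sub hW.one_sub hTW' (by rwa [sub_sub_cancel]) X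
    rwa [sub_sub_cancel] at this
  · intro h
    refine ⟨hγ, .of_forall_invariant (isPositiveMap_mapF_comp_mapG hγ)
      (isTraceSelfAdjoint_mapF_comp_mapG hγ.1) fun W hW hTW => ?_⟩
    obtain ⟨V, hV, h₁, h₂⟩ := exists_projection_trace_eq_zero hγ hW hTW
    have hb := (h W V hW hV).1 ⟨h₁, h₂⟩
    refine ⟨comp_mem_corner_of_trace_eq_zero hγ hW.one_sub hV.one_sub
      (by rwa [sub_sub_cancel]) (by rwa [sub_sub_cancel]), fun X => ⟨?_, ?_⟩⟩
    · rw [LinearMap.comp_apply, mapG_mul_mul_one_sub_eq_zero hW.isIdempotentElem hb, map_zero]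
    · have := mapG_mul_mul_one_sub_eq_zero (γ := γ) (W := 1 - W) (V := 1 - V)
        hW.one_sub.isIdempotentElem (by rw [sub_sub_cancel, sub_sub_cancel, add_comm]; exact hb) X
      rw [sub_sub_cancel] at this
      rw [LinearMap.comp_apply, this, map_zero]
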